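/- Let $L$ be a line segment of length $1$, $T$ a (filled) equilateral triangle of side $\frac12$, and $S$ a (filled) square of side $\frac13$, placed arbitrarily in the Euclidean plane. Then the convex hull of $L \cup T \cup S$ has area at least $0.227498$. -/

import Mathlib

/-- The Euclidean plane. -/
abbrev Plane : Type := EuclideanSpace ℝ (Fin 2)

/-- `L` is a (closed, straight) line segment of length `l` in the plane. -/
def IsSegmentOfLength (l : ℝ) (L : Set Plane) : Prop :=
  ∃ E F : Plane, dist E F = l ∧ L = segment ℝ E F

/-- `T` is a (closed, filled) equilateral triangle of side `s` in the plane. -/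
def IsEquilateralTriangle (s : ℝ) (T : Set Plane) : Prop :=
  ∃ P Q R : Plane, dist P Q = s ∧ dist Q R = s ∧ dist R P = s ∧
    T = convexHull ℝ {P, Q, R}

/-- `S` is a (closed, filled) square of side `s` in the plane: its consecutive vertices
`A, B, C, D` form a parallelogram with adjacent sides of length `s` and a right angle at `B`. -/
def IsSquareOfSide (s : ℝ) (S : Set Plane) : Prop :=
  ∃ A B C D : Plane, B - A = C - D ∧ dist A B = s ∧ dist B C = s ∧
    EuclideanGeometry.angle A B C = Real.pi / 2 ∧ S = convexHull ℝ {A, B, C, D}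

/-!
Write `K` for the convex hull, `l` for a unit vector along the segment, `e`, `n` for unit vectors
along the sides of the square, `t` for any of the three side vectors of the triangle, and `s = 1/3`
for the side of the square. Three families of lower bounds do not depend on how the figures are
translated.

* Two segments in `K` span a quadrilateral, so `2 area(K) ≥ |u × v|` for the two segment vectors
  `u`, `v` (`cross_le_two_mul_measureReal`). With `u = l` this gives `2 area(K) ≥ |l × t|` and, from
  the diagonals of the square, `2 area(K) ≥ s (|l · e| + |l · n|)`.
* `2 area(K) ≥ s (w₁ + w₂)`, where `w₁`, `w₂` are the widths of `K` in the directions `e`, `n`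
  (`square_bound`). This is monotonicity of mixed area, `area(K) ≥ V(K, square)`; it holds because
  the four triangles over the sides of the square with apices at the extreme points of `K` do not
  overlap. It gives `2 area(K) ≥ s (|l · e| + |n · t|)` and the same with `e` and `n` exchanged.

These bounds involve only the angles of the triangle and of the square against the segment. If
`2 area(K)` were less than `2 * 0.227498 = 0.454996`, the first family would leave only triangles
with a side within about 5.5° of the segment's direction and squares tilted by less than about
29.84°. On that range of angles `s (|l · e| + |n · t|)`, for a suitable steep side `t`, is at least
`0.454996`: it is a linear form in the unit vectors that record the two angles, so it suffices to
look at the ends of the two arcs (`side_bound`). At the worst end it exceeds `0.454996` by less than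
`10⁻⁶`, which is why the constants below carry eight digits.
-/

open MeasureTheory Set

/-! ### Areas of triangles and quadrilaterals -/

/-- The planar cross product. -/
def cross (u v : ℝ × ℝ) : ℝ := u.1 * v.2 - u.2 * v.1

/-- The open standard triangle. -/
def stdTriangle : Set (ℝ × ℝ) := {z | 0 < z.1 ∧ 0 < z.2 ∧ z.1 + z.2 < 1}

/-- The open triangle with vertex `p` and edge vectors `a`, `b` at `p`, as an affine image of the
standard triangle. If `a` and `b` are parallel it degenerates to a null set. -/
def openTriangle (p a b : ℝ × ℝ) : Set (ℝ × ℝ) :=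
  (fun z : ℝ × ℝ => p + (z.1 • a + z.2 • b)) '' stdTriangle

lemma volume_stdTriangle : volume stdTriangle = ENNReal.ofReal (1 / 2) := by
  have h : stdTriangle = regionBetween (fun _ : ℝ => (0 : ℝ)) (fun x => 1 - x) (Ioo 0 1) := by
    ext z
    simp only [stdTriangle, regionBetween, mem_ofPred_eq, mem_Ioo]
    constructor
    · rintro ⟨h1, h2, h3⟩
      refine ⟨⟨h1, ?_⟩, h2, ?_⟩ <;> linarith
    · rintro ⟨⟨h1, h2⟩, h3, h4⟩
      refine ⟨h1, h3, ?_⟩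
      linarith
  rw [h, Measure.volume_eq_prod, volume_regionBetween_eq_integral]
  · congr 1
    rw [← integral_Ioc_eq_integral_Ioo, ← intervalIntegral.integral_of_le zero_le_one]
    have h0 : ((fun x : ℝ => 1 - x) - fun _ => 0) = fun x : ℝ => 1 - x := by
      ext
      simp
    rw [h0, intervalIntegral.integral_sub (by simp) (by simp)]
    norm_num
  · exact integrableOn_const (by simp)
  · exact (Continuous.integrableOn_Icc (by fun_prop)).mono_set Ioo_subset_Icc_self
  · exact measurableSet_Ioo
  · intro x hx
    simp only [mem_Ioo] at hx
    linarith [hx.2]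

/-- The linear map with columns `a` and `b`. -/
noncomputable def columnMap (a b : ℝ × ℝ) : ℝ × ℝ →ₗ[ℝ] ℝ × ℝ :=
  Matrix.toLin (Module.Basis.finTwoProd ℝ) (Module.Basis.finTwoProd ℝ) !![a.1, b.1; a.2, b.2]

lemma columnMap_apply (a b z : ℝ × ℝ) : columnMap a b z = z.1 • a + z.2 • b := by
  rw [columnMap, Matrix.toLin_finTwoProd_apply]
  ext <;> simp <;> ring

lemma det_columnMap (a b : ℝ × ℝ) : LinearMap.det (columnMap a b) = cross a b := by
  rw [columnMap, LinearMap.det_toLin, Matrix.det_fin_two_of, cross]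
  ring

lemma volume_image_affine (p a b : ℝ × ℝ) (A : Set (ℝ × ℝ)) :
    volume ((fun z : ℝ × ℝ => p + (z.1 • a + z.2 • b)) '' A) =
      ENNReal.ofReal |cross a b| * volume A := by
  have h : (fun z : ℝ × ℝ => p + (z.1 • a + z.2 • b)) '' A =
      (fun w => p + w) '' (columnMap a b '' A) := by
    rw [image_image]
    simp only [columnMap_apply]
  rw [h, image_add_left, measure_preimage_add, Measure.addHaar_image_linearMap, det_columnMap]

lemma measureReal_openTriangle (p a b : ℝ × ℝ) :
    volume.real (openTriangle p a b) = |cross a b| / 2 := by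
  rw [Measure.real, openTriangle, volume_image_affine, volume_stdTriangle,
    ← ENNReal.ofReal_mul (abs_nonneg _), ENNReal.toReal_ofReal (by positivity)]
  ring

lemma convex_stdTriangle : Convex ℝ stdTriangle := by
  rintro x ⟨hx1, hx2, hx3⟩ y ⟨hy1, hy2, hy3⟩ a b ha hb hab
  rcases ha.eq_or_lt with rfl | ha
  · obtain rfl : b = 1 := by linarith
    simpa using ⟨hy1, hy2, hy3⟩
  · refine ⟨?_, ?_, ?_⟩ <;> simp
    · positivity
    · positivity
    · nlinarith

lemma nullMeasurableSet_openTriangle (p a b : ℝ × ℝ) :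
    NullMeasurableSet (openTriangle p a b) := by
  have h : openTriangle p a b = (fun w => p + w) '' (columnMap a b '' stdTriangle) := by
    rw [image_image, openTriangle]
    simp only [columnMap_apply]
  rw [h]
  exact ((convex_stdTriangle.linear_image _).translate p).nullMeasurableSet volume

lemma openTriangle_subset {K : Set (ℝ × ℝ)} (hK : Convex ℝ K) {p q r : ℝ × ℝ}
    (hp : p ∈ K) (hq : q ∈ K) (hr : r ∈ K) : openTriangle p (q - p) (r - p) ⊆ K := by
  rintro _ ⟨z, ⟨h1, h2, h3⟩, rfl⟩
  have h := hK.sum_mem (t := Finset.univ) (w := ![1 - z.1 - z.2, z.1, z.2]) (z := ![p, q, r])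
    (by intro i _; fin_cases i <;> simp <;> linarith)
    (by simp only [Fin.sum_univ_three, Matrix.cons_val]; ring)
    (by intro i _; fin_cases i <;> simpa)
  convert h using 1
  simp only [Fin.sum_univ_three, Matrix.cons_val]
  module

/-- Convex position is not needed: if `X` and `Y` lie on the same side of `PQ`, the left side is at
most twice the area of one of the triangles `PQX` and `PQY`. -/
lemma cross_le_two_mul_measureReal {K : Set (ℝ × ℝ)} (hK : Convex ℝ K) (hb : volume K ≠ ⊤)
    {P Q X Y : ℝ × ℝ} (hP : P ∈ K) (hQ : Q ∈ K) (hX : X ∈ K) (hY : Y ∈ K) :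
    cross (Q - P) (Y - X) ≤ 2 * volume.real K := by
  have tri : ∀ Z ∈ K, |cross (Q - P) (Z - P)| ≤ 2 * volume.real K := by
    intro Z hZ
    have h := measureReal_mono (openTriangle_subset hK hP hQ hZ) hb
    rw [measureReal_openTriangle] at h
    linarith
  have hXY : cross (Q - P) (Y - X) = cross (Q - P) (Y - P) - cross (Q - P) (X - P) := by
    simp only [cross, Prod.fst_sub, Prod.snd_sub]
    ring
  rcases le_or_gt 0 (cross (Q - P) (X - P)) with h | hx
  · linarith [tri Y hY, le_abs_self (cross (Q - P) (Y - P))]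
  rcases le_or_gt (cross (Q - P) (Y - P)) 0 with h | hy
  · linarith [tri X hX, neg_abs_le (cross (Q - P) (X - P))]
  have hd : Disjoint (openTriangle P (Q - P) (Y - P)) (openTriangle P (Q - P) (X - P)) := by
    rw [Set.disjoint_left]
    rintro _ ⟨z, ⟨-, hz, -⟩, rfl⟩ ⟨w, ⟨-, hw, -⟩, h⟩
    have e : cross (Q - P) (P + (w.1 • (Q - P) + w.2 • (X - P)) - P) =
        cross (Q - P) (P + (z.1 • (Q - P) + z.2 • (Y - P)) - P) :=
      congrArg (fun V => cross (Q - P) (V - P)) h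
    have e1 : ∀ (r t : ℝ) (V : ℝ × ℝ), cross (Q - P) (P + (r • (Q - P) + t • V) - P) =
        t * cross (Q - P) V := by
      intro r t V
      simp only [cross, Prod.fst_sub, Prod.snd_sub, Prod.fst_add, Prod.snd_add, Prod.smul_fst,
        Prod.smul_snd, smul_eq_mul]
      ring
    rw [e1, e1] at e
    nlinarith [mul_pos hz hy, mul_pos hw (neg_pos.2 hx)]
  have hu := measureReal_mono (union_subset (openTriangle_subset hK hP hQ hY)
    (openTriangle_subset hK hP hQ hX)) hb
  rw [measureReal_union₀ (nullMeasurableSet_openTriangle _ _ _) hd.aedisjoint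
    (measure_ne_top_of_subset (openTriangle_subset hK hP hQ hY) hb)
    (measure_ne_top_of_subset (openTriangle_subset hK hP hQ hX) hb),
    measureReal_openTriangle, measureReal_openTriangle, abs_of_pos hy, abs_of_neg hx] at hu
  linarith

/-! ### Area of a convex set containing a square -/

/-- The square and the four triangles over its sides, with apices at the points of `K` extreme in
the directions of the axes, have disjoint interiors and together area `s (w₁ + w₂) / 2`, where `w₁`
and `w₂` are the horizontal and vertical widths of `K`. -/
lemma square_bound_of_axis_parallel {K : Set (ℝ × ℝ)} (hK : Convex ℝ K) (hc : IsCompact K) {s : ℝ}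
    (hs : 0 < s) (h00 : ((0, 0) : ℝ × ℝ) ∈ K) (h10 : (s, (0 : ℝ)) ∈ K) (h01 : ((0 : ℝ), s) ∈ K)
    (h11 : (s, s) ∈ K) {P₁ P₂ Q₁ Q₂ : ℝ × ℝ} (hP₁ : P₁ ∈ K) (hP₂ : P₂ ∈ K) (hQ₁ : Q₁ ∈ K)
    (hQ₂ : Q₂ ∈ K) : s * ((P₁.1 - P₂.1) + (Q₁.2 - Q₂.2)) ≤ 2 * volume.real K := by
  have hfin : volume K ≠ ⊤ := hc.measure_lt_top.ne
  have hne : K.Nonempty := ⟨_, h00⟩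
  obtain ⟨R, hR, hRmax⟩ := hc.exists_isMaxOn hne continuous_fst.continuousOn
  obtain ⟨L, hL, hLmin⟩ := hc.exists_isMinOn hne continuous_fst.continuousOn
  obtain ⟨U, hU, hUmax⟩ := hc.exists_isMaxOn hne continuous_snd.continuousOn
  obtain ⟨D, hD, hDmin⟩ := hc.exists_isMinOn hne continuous_snd.continuousOn
  rw [isMaxOn_iff] at hRmax hUmax
  rw [isMinOn_iff] at hLmin hDmin
  have hRs : s ≤ R.1 := hRmax _ h11
  have hUs : s ≤ U.2 := hUmax _ h11
  have hL0 : L.1 ≤ 0 := hLmin _ h00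
  have hD0 : D.2 ≤ 0 := hDmin _ h00
  have sR := openTriangle_subset hK h11 h10 hR
  have sU := openTriangle_subset hK h11 h01 hU
  have sL := openTriangle_subset hK h00 h01 hL
  have sD := openTriangle_subset hK h00 h10 hD
  set TR := openTriangle (s, s) ((s, 0) - (s, s)) (R - (s, s)) with hTR
  set TU := openTriangle (s, s) ((0, s) - (s, s)) (U - (s, s)) with hTU
  set TL := openTriangle (0, 0) ((0, s) - (0, 0)) (L - (0, 0)) with hTL
  set TD := openTriangle (0, 0) ((s, 0) - (0, 0)) (D - (0, 0)) with hTD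
  -- A point of a triangle lies at the fraction `v` of the way from the edge to the apex, strictly
  -- between the two other edges.
  have mR : ∀ z ∈ TR, ∃ v, 0 < v ∧ z.1 = s + v * (R.1 - s) ∧ v * R.2 < z.2 ∧
      z.2 < s + v * (R.2 - s) := by
    rintro _ ⟨w, ⟨w1, w2, w3⟩, rfl⟩
    refine ⟨w.2, w2, ?_, ?_, ?_⟩ <;> simp <;> nlinarith [mul_pos hs w1]
  have mU : ∀ z ∈ TU, ∃ v, 0 < v ∧ z.2 = s + v * (U.2 - s) ∧ v * U.1 < z.1 ∧
      z.1 < s + v * (U.1 - s) := by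
    rintro _ ⟨w, ⟨w1, w2, w3⟩, rfl⟩
    refine ⟨w.2, w2, ?_, ?_, ?_⟩ <;> simp <;> nlinarith [mul_pos hs w1]
  have mL : ∀ z ∈ TL, ∃ v, 0 < v ∧ z.1 = v * L.1 ∧ v * L.2 < z.2 ∧
      z.2 < s + v * (L.2 - s) := by
    rintro _ ⟨w, ⟨w1, w2, w3⟩, rfl⟩
    refine ⟨w.2, w2, ?_, ?_, ?_⟩ <;> simp <;> nlinarith [mul_pos hs w1]
  have mD : ∀ z ∈ TD, ∃ v, 0 < v ∧ z.2 = v * D.2 ∧ v * D.1 < z.1 ∧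
      z.1 < s + v * (D.1 - s) := by
    rintro _ ⟨w, ⟨w1, w2, w3⟩, rfl⟩
    refine ⟨w.2, w2, ?_, ?_, ?_⟩ <;> simp <;> nlinarith [mul_pos hs w1]
  set SQ : Set (ℝ × ℝ) := Ioo 0 s ×ˢ Ioo 0 s with hSQ
  have sS : SQ ⊆ K := by
    rintro z ⟨⟨x0, x1⟩, y0, y1⟩
    have a0 : (z.1, (0 : ℝ)) ∈ K := by
      have := hK h00 h10 (show 0 ≤ 1 - z.1 / s by rw [sub_nonneg, div_le_one hs]; exact x1.le)
        (show 0 ≤ z.1 / s by positivity) (by ring)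
      convert this using 1
      ext <;> simp [hs.ne']
    have a1 : (z.1, s) ∈ K := by
      have := hK h01 h11 (show 0 ≤ 1 - z.1 / s by rw [sub_nonneg, div_le_one hs]; exact x1.le)
        (show 0 ≤ z.1 / s by positivity) (by ring)
      convert this using 1
      ext <;> simp [hs.ne']
      field_simp
      ring
    have := hK a0 a1 (show 0 ≤ 1 - z.2 / s by rw [sub_nonneg, div_le_one hs]; exact y1.le)
      (show 0 ≤ z.2 / s by positivity) (by ring)
    convert this using 1
    ext <;> simp [hs.ne']
    field_simp
    ring
  have dS : ∀ z ∈ SQ, 0 < z.1 ∧ z.1 < s ∧ 0 < z.2 ∧ z.2 < s := by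
    rintro z ⟨⟨x0, x1⟩, y0, y1⟩
    exact ⟨x0, x1, y0, y1⟩
  have dSR : Disjoint SQ TR := by
    rw [Set.disjoint_left]
    intro z hz hz'
    obtain ⟨v, v0, e, -, -⟩ := mR z hz'
    nlinarith [dS z hz, mul_nonneg v0.le (sub_nonneg.2 hRs)]
  have dSU : Disjoint SQ TU := by
    rw [Set.disjoint_left]
    intro z hz hz'
    obtain ⟨v, v0, e, -, -⟩ := mU z hz'
    nlinarith [dS z hz, mul_nonneg v0.le (sub_nonneg.2 hUs)]
  have dSL : Disjoint SQ TL := by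
    rw [Set.disjoint_left]
    intro z hz hz'
    obtain ⟨v, v0, e, -, -⟩ := mL z hz'
    nlinarith [dS z hz, mul_nonneg v0.le (neg_nonneg.2 hL0)]
  have dSD : Disjoint SQ TD := by
    rw [Set.disjoint_left]
    intro z hz hz'
    obtain ⟨v, v0, e, -, -⟩ := mD z hz'
    nlinarith [dS z hz, mul_nonneg v0.le (neg_nonneg.2 hD0)]
  have dRL : Disjoint TR TL := by
    rw [Set.disjoint_left]
    intro z hz hz'
    obtain ⟨v, v0, e, -, -⟩ := mR z hz
    obtain ⟨v', v0', e', -, -⟩ := mL z hz'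
    nlinarith [mul_nonneg v0.le (sub_nonneg.2 hRs), mul_nonneg v0'.le (neg_nonneg.2 hL0)]
  have dUD : Disjoint TU TD := by
    rw [Set.disjoint_left]
    intro z hz hz'
    obtain ⟨v, v0, e, -, -⟩ := mU z hz
    obtain ⟨v', v0', e', -, -⟩ := mD z hz'
    nlinarith [mul_nonneg v0.le (sub_nonneg.2 hUs), mul_nonneg v0'.le (neg_nonneg.2 hD0)]
  -- Triangles over adjacent edges: as each apex is extreme in its own direction, the line through
  -- the common corner and either apex separates them.
  have dRU : Disjoint TR TU := by
    rw [Set.disjoint_left]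
    intro z hz hz'
    obtain ⟨v, v0, e, -, f⟩ := mR z hz
    obtain ⟨v', v0', e', -, f'⟩ := mU z hz'
    have g1 := mul_le_mul_of_nonneg_left (hRmax U hU) v0'.le
    have g2 := mul_le_mul_of_nonneg_left (hUmax R hR) v0.le
    rcases le_total v v' with h | h <;>
      nlinarith [mul_nonneg (sub_nonneg.2 h) (sub_nonneg.2 hRs),
        mul_nonneg (sub_nonneg.2 h) (sub_nonneg.2 hUs)]
  have dRD : Disjoint TR TD := by
    rw [Set.disjoint_left]
    intro z hz hz'
    obtain ⟨v, v0, e, f, -⟩ := mR z hz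
    obtain ⟨v', v0', e', -, f'⟩ := mD z hz'
    have g1 := mul_le_mul_of_nonneg_left (hRmax D hD) v0'.le
    have g2 := mul_le_mul_of_nonneg_left (hDmin R hR) v0.le
    rcases le_total v v' with h | h <;>
      nlinarith [mul_nonneg (sub_nonneg.2 h) (sub_nonneg.2 hRs),
        mul_nonneg (sub_nonneg.2 h) (neg_nonneg.2 hD0)]
  have dUL : Disjoint TU TL := by
    rw [Set.disjoint_left]
    intro z hz hz'
    obtain ⟨v, v0, e, f, -⟩ := mU z hz
    obtain ⟨v', v0', e', -, f'⟩ := mL z hz'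
    have g1 := mul_le_mul_of_nonneg_left (hUmax L hL) v0'.le
    have g2 := mul_le_mul_of_nonneg_left (hLmin U hU) v0.le
    rcases le_total v v' with h | h <;>
      nlinarith [mul_nonneg (sub_nonneg.2 h) (sub_nonneg.2 hUs),
        mul_nonneg (sub_nonneg.2 h) (neg_nonneg.2 hL0)]
  have dLD : Disjoint TL TD := by
    rw [Set.disjoint_left]
    intro z hz hz'
    obtain ⟨v, v0, e, f, -⟩ := mL z hz
    obtain ⟨v', v0', e', f', -⟩ := mD z hz'
    have g1 := mul_le_mul_of_nonneg_left (hLmin D hD) v0'.le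
    have g2 := mul_le_mul_of_nonneg_left (hDmin L hL) v0.le
    rcases le_total v v' with h | h <;>
      nlinarith [mul_nonneg (sub_nonneg.2 h) (neg_nonneg.2 hL0),
        mul_nonneg (sub_nonneg.2 h) (neg_nonneg.2 hD0)]
  have add : ∀ A B : Set (ℝ × ℝ), A ⊆ K → B ⊆ K → NullMeasurableSet B → Disjoint A B →
      volume.real (A ∪ B) = volume.real A + volume.real B := fun A B hA hB hm hd =>
    measureReal_union₀ hm hd.aedisjoint (measure_ne_top_of_subset hA hfin)
      (measure_ne_top_of_subset hB hfin)
  have nR : NullMeasurableSet TR := nullMeasurableSet_openTriangle _ _ _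
  have nU : NullMeasurableSet TU := nullMeasurableSet_openTriangle _ _ _
  have nL : NullMeasurableSet TL := nullMeasurableSet_openTriangle _ _ _
  have nD : NullMeasurableSet TD := nullMeasurableSet_openTriangle _ _ _
  have key : volume.real ((((SQ ∪ TR) ∪ TU) ∪ TL) ∪ TD) ≤ volume.real K :=
    measureReal_mono (union_subset (union_subset (union_subset (union_subset sS sR) sU) sL) sD) hfin
  rw [add _ _ (union_subset (union_subset (union_subset sS sR) sU) sL) sD nD
      (((dSD.union_left dRD).union_left dUD).union_left dLD),
    add _ _ (union_subset (union_subset sS sR) sU) sL nL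
      ((dSL.union_left dRL).union_left dUL),
    add _ _ (union_subset sS sR) sU nU (dSU.union_left dRU), add _ _ sS sR nR dSR] at key
  have vS : volume.real SQ = s * s := by
    rw [hSQ, Measure.volume_eq_prod, measureReal_prod_prod]
    simp [hs.le]
  have vR : volume.real TR = s * (R.1 - s) / 2 := by
    rw [hTR, measureReal_openTriangle, abs_of_nonneg] <;> simp [cross] <;>
      nlinarith [mul_nonneg hs.le (sub_nonneg.2 hRs)]
  have vU : volume.real TU = s * (U.2 - s) / 2 := by
    rw [hTU, measureReal_openTriangle, abs_of_nonpos] <;> simp [cross] <;>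
      nlinarith [mul_nonneg hs.le (sub_nonneg.2 hUs)]
  have vL : volume.real TL = s * (-L.1) / 2 := by
    rw [hTL, measureReal_openTriangle, abs_of_nonneg] <;> simp [cross] <;>
      nlinarith [mul_nonneg hs.le (neg_nonneg.2 hL0)]
  have vD : volume.real TD = s * (-D.2) / 2 := by
    rw [hTD, measureReal_openTriangle, abs_of_nonpos] <;> simp [cross] <;>
      nlinarith [mul_nonneg hs.le (neg_nonneg.2 hD0)]
  rw [vS, vR, vU, vL, vD] at key
  have := hRmax _ hP₁
  have := hLmin _ hP₂
  have := hUmax _ hQ₁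
  have := hDmin _ hQ₂
  calc s * ((P₁.1 - P₂.1) + (Q₁.2 - Q₂.2)) ≤ s * ((R.1 - L.1) + (U.2 - D.2)) := by
        apply mul_le_mul_of_nonneg_left _ hs.le
        linarith
    _ ≤ 2 * volume.real K := by linarith

/-- The square has vertex `B` and sides along the unit vector `(c, d)` and its quarter turn
`(-d, c)`; a rigid motion makes it axis-parallel. -/
lemma square_bound {K : Set (ℝ × ℝ)} (hK : Convex ℝ K) (hc : IsCompact K) {s c d : ℝ} (hs : 0 < s)
    (hcd : c ^ 2 + d ^ 2 = 1) {B : ℝ × ℝ} (h00 : B ∈ K) (h10 : B + s • (c, d) ∈ K)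
    (h01 : B + s • (-d, c) ∈ K) (h11 : B + s • (c, d) + s • (-d, c) ∈ K) {P₁ P₂ Q₁ Q₂ : ℝ × ℝ}
    (hP₁ : P₁ ∈ K) (hP₂ : P₂ ∈ K) (hQ₁ : Q₁ ∈ K) (hQ₂ : Q₂ ∈ K) :
    s * ((c * (P₁.1 - P₂.1) + d * (P₁.2 - P₂.2)) + (-d * (Q₁.1 - Q₂.1) + c * (Q₁.2 - Q₂.2))) ≤
      2 * volume.real K := by
  set f : ℝ × ℝ → ℝ × ℝ := fun z =>
    (-(c * B.1 + d * B.2), -(-d * B.1 + c * B.2)) + (z.1 • (c, -d) + z.2 • (d, c)) with hf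
  have hv : volume.real (f '' K) = volume.real K := by
    rw [Measure.real, hf, volume_image_affine, cross,
      show c * c - -d * d = 1 by linarith, abs_one, ENNReal.ofReal_one, one_mul, Measure.real]
  have hconv : Convex ℝ (f '' K) := by
    have h : f '' K = (fun w => (-(c * B.1 + d * B.2), -(-d * B.1 + c * B.2)) + w) ''
        (columnMap (c, -d) (d, c) '' K) := by
      rw [image_image]
      simp only [columnMap_apply, hf]
    rw [h]
    exact (hK.linear_image _).translate _
  have hcomp : IsCompact (f '' K) := hc.image (by rw [hf]; fun_prop)
  have hmem : ∀ z ∈ K, f z ∈ f '' K := fun z hz => mem_image_of_mem f hz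
  have k00 : f B = (0, 0) := by
    ext <;> simp [hf] <;> ring
  have k10 : f (B + s • (c, d)) = (s, 0) := by
    ext <;> simp [hf]
    · linear_combination s * hcd
    · ring
  have k01 : f (B + s • (-d, c)) = (0, s) := by
    ext <;> simp [hf]
    · ring
    · linear_combination s * hcd
  have k11 : f (B + s • (c, d) + s • (-d, c)) = (s, s) := by
    ext <;> simp [hf] <;> linear_combination s * hcd
  have h := square_bound_of_axis_parallel hconv hcomp hs (k00 ▸ hmem _ h00) (k10 ▸ hmem _ h10)
    (k01 ▸ hmem _ h01) (k11 ▸ hmem _ h11) (hmem _ hP₁) (hmem _ hP₂) (hmem _ hQ₁) (hmem _ hQ₂)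
  rw [hv] at h
  refine le_trans (le_of_eq ?_) h
  simp only [hf, Prod.fst_add, Prod.snd_add, Prod.smul_fst, Prod.smul_snd, smul_eq_mul]
  ring

lemma square_bound_abs {K : Set (ℝ × ℝ)} (hK : Convex ℝ K) (hc : IsCompact K) {s c d : ℝ}
    (hs : 0 < s) (hcd : c ^ 2 + d ^ 2 = 1) {B : ℝ × ℝ} (h00 : B ∈ K) (h10 : B + s • (c, d) ∈ K)
    (h01 : B + s • (-d, c) ∈ K) (h11 : B + s • (c, d) + s • (-d, c) ∈ K) {P₁ P₂ Q₁ Q₂ : ℝ × ℝ}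
    (hP₁ : P₁ ∈ K) (hP₂ : P₂ ∈ K) (hQ₁ : Q₁ ∈ K) (hQ₂ : Q₂ ∈ K) :
    s * (|c * (P₁.1 - P₂.1) + d * (P₁.2 - P₂.2)| + |-d * (Q₁.1 - Q₂.1) + c * (Q₁.2 - Q₂.2)|) ≤
      2 * volume.real K := by
  rcases abs_cases (c * (P₁.1 - P₂.1) + d * (P₁.2 - P₂.2)) with ⟨h, -⟩ | ⟨h, -⟩ <;>
  rcases abs_cases (-d * (Q₁.1 - Q₂.1) + c * (Q₁.2 - Q₂.2)) with ⟨h', -⟩ | ⟨h', -⟩ <;>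
  rw [h, h']
  · exact square_bound hK hc hs hcd h00 h10 h01 h11 hP₁ hP₂ hQ₁ hQ₂
  · refine le_trans (le_of_eq ?_) (square_bound hK hc hs hcd h00 h10 h01 h11 hP₁ hP₂ hQ₂ hQ₁)
    ring
  · refine le_trans (le_of_eq ?_) (square_bound hK hc hs hcd h00 h10 h01 h11 hP₂ hP₁ hQ₁ hQ₂)
    ring
  · refine le_trans (le_of_eq ?_) (square_bound hK hc hs hcd h00 h10 h01 h11 hP₂ hP₁ hQ₂ hQ₁)
    ring

/-! ### The inequality between the angles -/

/-- The part `0 ≤ D ≤ C`, `C + D ≤ 1.364988 = 3 * 0.454996` of the unit circle is an arc from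
`(1, 0)` to nearly `(0.86743166, 0.49755634)`. It lies above the line of slope `-0.26643885` through
`(1, 0)`, a rounding of its chord, so a form that decreases along this line is least at the end. -/
lemma arc_bound {C D u v : ℝ} (h : C ^ 2 + D ^ 2 = 1) (hD : 0 ≤ D) (hDC : D ≤ C)
    (hk : C + D ≤ 1.364988) (hu : 0 ≤ u) (huv : v ≤ 0.26643885 * u) :
    (1 - 0.26643885 * 0.49755634) * u + 0.49755634 * v ≤ u * C + v * D := by
  have h1 : D ≤ 0.49755634 := by
    by_contra! hlt
    nlinarith [mul_pos (sub_pos.2 hlt) (show 0 < 0.86743166 - D by nlinarith)]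
  have h2 : 1 - 0.26643885 * D ≤ C := by
    by_contra! hlt
    nlinarith
  nlinarith [mul_nonneg (sub_nonneg.2 h1) (sub_nonneg.2 huv), mul_nonneg hu (sub_nonneg.2 h2)]

/-- An arc of the unit circle lies above a line slightly steeper than its chord. The number
`0.909992 = 2 * 0.454996` is a bound for the sines of the sides of the triangle against the
segment, and `0.4146258` rounds down the corresponding cosine. -/
lemma chord_bound {a b : ℝ} (h : a ^ 2 + b ^ 2 = 1) (ha : 0.4146258 ≤ a) (ha' : a ≤ 1 / 2)
    (hb : 0 ≤ b) : 0.909992 - 0.55 * (a - 0.4146258) ≤ b := by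
  by_contra! hlt
  nlinarith [mul_nonneg (sub_nonneg.2 ha) (sub_nonneg.2 ha')]

/-- Here `(C, D)` holds the absolute values of the components of the square's first axis, and
`(a, b)` those of the direction of the steepest side of the triangle. The two conclusions are for this side and for the other steep side, which makes with the
segment's normal an angle of 60° less the angle of the first, on the opposite side. -/
lemma steep_side_bound {C D a b : ℝ} (h : C ^ 2 + D ^ 2 = 1) (hD : 0 ≤ D) (hDC : D ≤ C)
    (hk : C + D ≤ 1.364988) (hab : a ^ 2 + b ^ 2 = 1) (ha : 0 ≤ a) (hb : 0 ≤ b)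
    (hb' : b ≤ 0.909992) (h3 : 3 * a ^ 2 ≤ b ^ 2) :
    2.729976 ≤ 2 * C + (C * b + D * a) ∧
    2.729976 ≤ 2 * C + (C * (b / 2 + √3 / 2 * a) + D * (√3 / 2 * b - a / 2)) := by
  have r1 : 1.7320508 ≤ √3 := Real.le_sqrt_of_sq_le (by norm_num)
  have r2 : √3 ≤ 1.7320509 := Real.sqrt_le_iff.2 (by norm_num)
  have ha1 : 0.4146258 ≤ a := by
    by_contra! hlt
    nlinarith
  have ha2 : a ≤ 1 / 2 := by
    by_contra! hlt
    nlinarith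
  have hc := chord_bound hab ha1 ha2 hb
  have e1 : 1.7320508 * a ≤ √3 * a := mul_le_mul_of_nonneg_right r1 ha
  have e2 : 1.7320508 * b ≤ √3 * b := mul_le_mul_of_nonneg_right r1 hb
  have e3 : √3 * b ≤ 1.7320509 * b := mul_le_mul_of_nonneg_right r2 hb
  have h1 := arc_bound h hD hDC hk (u := 2 + b) (v := a) (by linarith) (by linarith)
  have h2 := arc_bound h hD hDC hk (u := 2 + (b / 2 + √3 / 2 * a)) (v := √3 / 2 * b - a / 2)
    (by linarith) (by linarith)
  constructor <;> linarith

lemma abs_sub_of_mul_nonpos {x y : ℝ} (h : x * y ≤ 0) : |x - y| = |x| + |y| := by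
  have := abs_add_eq_add_abs_iff x (-y)
  rw [abs_neg, ← sub_eq_add_neg] at this
  rw [this]
  rcases mul_nonpos_iff.1 h with h | h
  · exact Or.inl ⟨h.1, by linarith [h.2]⟩
  · exact Or.inr ⟨h.1, by linarith [h.2]⟩

/-- The vector `(-p / 2 - y * q, -q / 2 + y * p)` is `(p, q)` turned by ±120°, as `y = ±√3 / 2`. Of
the two turns, `h2` picks the one that leads to the steeper vector. -/
lemma le_abs_rotated {c d p q y : ℝ} (hy : y ^ 2 = 3 / 4) (h1 : 0 < (c * q) * (d * p))
    (h2 : y * p * q ≤ 0) :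
    |c| * (|q| / 2 + √3 / 2 * |p|) + |d| * (√3 / 2 * |q| - |p| / 2) ≤
      |c * (-q / 2 + y * p) - d * (-p / 2 - y * q)| := by
  have hy' : |y| = √3 / 2 := by
    rw [← Real.sqrt_sq_eq_abs, hy, Real.sqrt_div (by norm_num),
      show (4 : ℝ) = 2 ^ 2 by norm_num, Real.sqrt_sq (by norm_num)]
  have e : |c| * (|q| / 2 + √3 / 2 * |p|) + |d| * (√3 / 2 * |q| - |p| / 2) =
      |c * q| / 2 + |c * (y * p)| + |d * (y * q)| - |d * p| / 2 := by
    simp only [abs_mul, hy']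
    ring
  have k1 : (c * q) * (c * (y * p)) ≤ 0 := by
    nlinarith [mul_nonneg (sq_nonneg c) (neg_nonneg.2 h2)]
  have k2 : (d * p) * (d * (y * q)) ≤ 0 := by
    nlinarith [mul_nonneg (sq_nonneg d) (neg_nonneg.2 h2)]
  rw [e]
  rcases pos_and_pos_or_neg_and_neg_of_mul_pos h1 with ⟨hx, hz⟩ | ⟨hx, hz⟩
  · have k3 : c * (y * p) ≤ 0 := by
      by_contra! hlt
      exact absurd (mul_pos hx hlt) (not_lt.2 k1)
    have k4 : d * (y * q) ≤ 0 := by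
      by_contra! hlt
      exact absurd (mul_pos hz hlt) (not_lt.2 k2)
    rw [abs_of_pos hx, abs_of_pos hz, abs_of_nonpos k3, abs_of_nonpos k4]
    refine le_trans (le_of_eq ?_) (neg_le_abs _)
    ring
  · have k3 : 0 ≤ c * (y * p) := by
      by_contra! hlt
      exact absurd (mul_pos_of_neg_of_neg hx hlt) (not_lt.2 k1)
    have k4 : 0 ≤ d * (y * q) := by
      by_contra! hlt
      exact absurd (mul_pos_of_neg_of_neg hz hlt) (not_lt.2 k2)
    rw [abs_of_neg hx, abs_of_neg hz, abs_of_nonneg k3, abs_of_nonneg k4]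
    refine le_trans (le_of_eq ?_) (le_abs_self _)
    ring

/-- The vectors `(pᵢ, qᵢ)` are the sides of an equilateral triangle, the third being the steepest.
If its slope and that of the square's second axis `(-d, c)` have the same sign, that side gives the
bound, otherwise one of the other two does. -/
lemma steepest_side_bound {c d p₁ q₁ p₂ q₂ p₃ q₃ : ℝ} (hcd : c ^ 2 + d ^ 2 = 1) (hdc : |d| ≤ |c|)
    (hk : |c| + |d| ≤ 1.364988) (h₁ : p₁ ^ 2 + q₁ ^ 2 = 1) (h₂ : p₂ ^ 2 + q₂ ^ 2 = 1)
    (h₃ : p₃ ^ 2 + q₃ ^ 2 = 1) (hp : p₁ + p₂ + p₃ = 0) (hq : q₁ + q₂ + q₃ = 0)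
    (hq₃ : |q₃| ≤ 0.909992) (h13 : |q₁| ≤ |q₃|) (h23 : |q₂| ≤ |q₃|) {w : ℝ}
    (w₁ : |c * q₁ - d * p₁| ≤ w) (w₂ : |c * q₂ - d * p₂| ≤ w) (w₃ : |c * q₃ - d * p₃| ≤ w) :
    2.729976 ≤ 2 * |c| + w := by
  obtain rfl : p₂ = -p₁ - p₃ := by linarith
  obtain rfl : q₂ = -q₁ - q₃ := by linarith
  -- `y` is the cross product of the third and the first side.
  obtain ⟨y, hy⟩ : ∃ y, y = p₃ * q₁ - q₃ * p₁ := ⟨_, rfl⟩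
  have hdot : p₁ * p₃ + q₁ * q₃ = -1 / 2 := by linarith
  have ep : p₁ = -p₃ / 2 - y * q₃ := by
    rw [hy]
    linear_combination (-p₁) * h₃ + p₃ * hdot
  have eq : q₁ = -q₃ / 2 + y * p₃ := by
    rw [hy]
    linear_combination (-q₁) * h₃ + q₃ * hdot
  have hy2 : y ^ 2 = 3 / 4 := by
    rw [hy]
    linear_combination h₁ * (p₃ ^ 2 + q₃ ^ 2) + h₃ - (p₁ * p₃ + q₁ * q₃ - 1 / 2) * hdot
  -- The steepest side is within 30° of the vertical.
  have hs : 3 * |p₃| ^ 2 ≤ |q₃| ^ 2 := by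
    have m1 := sq_le_sq.2 h13
    have m2 := sq_le_sq.2 h23
    have m3 : 0 ≤ q₁ * (-q₁ - q₃) := by
      by_contra! hlt
      nlinarith [mul_self_nonneg (q₁ + 2 * (-q₁ - q₃))]
    rw [sq_abs, sq_abs]
    have m4 : y * p₃ = q₁ + q₃ / 2 := by linarith
    have m5 : 3 / 4 * p₃ ^ 2 = (q₁ + q₃ / 2) ^ 2 := by rw [← m4, ← hy2]; ring
    nlinarith
  obtain ⟨b1, b2⟩ := steep_side_bound (C := |c|) (D := |d|) (a := |p₃|) (b := |q₃|)
    (by simpa using hcd) (abs_nonneg _) hdc hk (by simpa using h₃) (abs_nonneg _) (abs_nonneg _)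
    hq₃ hs
  rcases le_or_gt ((c * q₃) * (d * p₃)) 0 with h | h
  · rw [abs_sub_of_mul_nonpos h, abs_mul, abs_mul] at w₃
    linarith
  rcases le_or_gt (y * p₃ * q₃) 0 with h' | h'
  · have := le_abs_rotated hy2 h h'
    rw [← ep, ← eq] at this
    linarith
  · have := le_abs_rotated (y := -y) (by rw [neg_sq]; exact hy2) h (by linarith)
    rw [show -q₃ / 2 + -y * p₃ = -q₁ - q₃ by linarith,
      show -p₃ / 2 - -y * q₃ = -p₁ - p₃ by linarith] at this
    linarith

/-- The unit vectors `(pᵢ, qᵢ)` are the sides of the triangle, scaled to length 1, and `(c, d)` is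
the first axis of the square, in a frame whose first axis is the segment; `w` bounds the width of
the scaled triangle along the square's second axis. -/
lemma side_bound {c d p₁ q₁ p₂ q₂ p₃ q₃ : ℝ} (hcd : c ^ 2 + d ^ 2 = 1) (hdc : |d| ≤ |c|)
    (hk : |c| + |d| ≤ 1.364988) (h₁ : p₁ ^ 2 + q₁ ^ 2 = 1) (h₂ : p₂ ^ 2 + q₂ ^ 2 = 1)
    (h₃ : p₃ ^ 2 + q₃ ^ 2 = 1) (hp : p₁ + p₂ + p₃ = 0) (hq : q₁ + q₂ + q₃ = 0)
    (hq₁ : |q₁| ≤ 0.909992) (hq₂ : |q₂| ≤ 0.909992) (hq₃ : |q₃| ≤ 0.909992) {w : ℝ}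
    (w₁ : |c * q₁ - d * p₁| ≤ w) (w₂ : |c * q₂ - d * p₂| ≤ w) (w₃ : |c * q₃ - d * p₃| ≤ w) :
    2.729976 ≤ 2 * |c| + w := by
  rcases le_total |q₁| |q₂| with h12 | h12
  · rcases le_total |q₂| |q₃| with h23 | h23
    · exact steepest_side_bound hcd hdc hk h₁ h₂ h₃ hp hq hq₃ (h12.trans h23) h23 w₁ w₂ w₃
    · exact steepest_side_bound hcd hdc hk h₃ h₁ h₂ (by linarith) (by linarith) hq₂ h23 h12
        w₃ w₁ w₂
  · rcases le_total |q₁| |q₃| with h13 | h13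
    · exact steepest_side_bound hcd hdc hk h₁ h₂ h₃ hp hq hq₃ h13 (h12.trans h13) w₁ w₂ w₃
    · exact steepest_side_bound hcd hdc hk h₂ h₃ h₁ (by linarith) (by linarith) hq₁ h12 h13
        w₂ w₃ w₁

/-! ### The bound in coordinates -/

lemma area_bound {K : Set (ℝ × ℝ)} (hK : Convex ℝ K) (hc : IsCompact K)
    {E F P Q R B : ℝ × ℝ} {c d : ℝ} (hE : E ∈ K) (hF : F ∈ K) (hP : P ∈ K) (hQ : Q ∈ K)
    (hR : R ∈ K) (hEF : (F.1 - E.1) ^ 2 + (F.2 - E.2) ^ 2 = 1)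
    (hPQ : (Q.1 - P.1) ^ 2 + (Q.2 - P.2) ^ 2 = 1 / 4)
    (hQR : (R.1 - Q.1) ^ 2 + (R.2 - Q.2) ^ 2 = 1 / 4)
    (hRP : (P.1 - R.1) ^ 2 + (P.2 - R.2) ^ 2 = 1 / 4)
    (hcd : c ^ 2 + d ^ 2 = 1) (h00 : B ∈ K) (h10 : B + (1 / 3 : ℝ) • (c, d) ∈ K)
    (h01 : B + (1 / 3 : ℝ) • (-d, c) ∈ K)
    (h11 : B + (1 / 3 : ℝ) • (c, d) + (1 / 3 : ℝ) • (-d, c) ∈ K) :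
    0.227498 ≤ volume.real K := by
  by_contra! hlt
  have hfin : volume K ≠ ⊤ := hc.measure_lt_top.ne
  have quad : ∀ X ∈ K, ∀ Y ∈ K, |cross (F - E) (Y - X)| ≤ 2 * volume.real K := by
    intro X hX Y hY
    rw [abs_le']
    refine ⟨cross_le_two_mul_measureReal hK hfin hE hF hX hY,
      le_trans (le_of_eq ?_) (cross_le_two_mul_measureReal hK hfin hE hF hY hX)⟩
    simp only [cross, Prod.fst_sub, Prod.snd_sub]
    ring
  obtain ⟨x, hx⟩ : ∃ x, x = F.1 - E.1 := ⟨_, rfl⟩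
  obtain ⟨y, hy⟩ : ∃ y, y = F.2 - E.2 := ⟨_, rfl⟩
  rw [← hx, ← hy] at hEF
  -- The components of the square's first axis in the frame of the segment.
  obtain ⟨C, hC⟩ : ∃ C, C = x * c + y * d := ⟨_, rfl⟩
  obtain ⟨D, hD⟩ : ∃ D, D = x * d - y * c := ⟨_, rfl⟩
  have hCD : C ^ 2 + D ^ 2 = 1 := by
    rw [hC, hD]
    linear_combination (c ^ 2 + d ^ 2) * hEF + hcd
  have diag₁ : |D + C| ≤ 3 * (2 * volume.real K) := by
    have h := quad _ h00 _ h11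
    rw [show cross (F - E) (B + (1 / 3 : ℝ) • (c, d) + (1 / 3 : ℝ) • (-d, c) - B) =
      (1 / 3) * (D + C) by simp [cross, hC, hD, hx, hy]; ring, abs_mul,
      abs_of_pos (by norm_num : (0 : ℝ) < 1 / 3)] at h
    linarith
  have diag₂ : |D - C| ≤ 3 * (2 * volume.real K) := by
    have h := quad _ h01 _ h10
    rw [show cross (F - E) (B + (1 / 3 : ℝ) • (c, d) - (B + (1 / 3 : ℝ) • (-d, c))) =
      (1 / 3) * (D - C) by simp [cross, hC, hD, hx, hy]; ring, abs_mul,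
      abs_of_pos (by norm_num : (0 : ℝ) < 1 / 3)] at h
    linarith
  have hk : |C| + |D| ≤ 1.364988 := by
    have h1 := abs_le.1 diag₁
    have h2 := abs_le.1 diag₂
    rcases abs_cases C with ⟨e, -⟩ | ⟨e, -⟩ <;> rcases abs_cases D with ⟨e', -⟩ | ⟨e', -⟩ <;>
      rw [e, e'] <;> linarith
  -- Twice the components of the side `XY` of the triangle in the frame of the segment.
  have side : ∀ X ∈ K, ∀ Y ∈ K, ∀ p q : ℝ,
      p = 2 * ((Y.1 - X.1) * x + (Y.2 - X.2) * y) → q = 2 * (x * (Y.2 - X.2) - y * (Y.1 - X.1)) →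
      |q| ≤ 0.909992 ∧ |C * q - D * p| ≤ 6 * (2 * volume.real K) - 2 * |C| ∧
      |D * q - -C * p| ≤ 6 * (2 * volume.real K) - 2 * |D| := by
    intro X hX Y hY p q hp hq
    have h1 := quad X hX Y hY
    rw [show cross (F - E) (Y - X) = (1 / 2) * q by simp [cross, hq, hx, hy], abs_mul,
      abs_of_pos (by norm_num : (0 : ℝ) < 1 / 2)] at h1
    have h2 := square_bound_abs hK hc (by norm_num) hcd h00 h10 h01 h11 hF hE hY hX
    rw [show c * (F.1 - E.1) + d * (F.2 - E.2) = C by rw [hC, hx, hy]; ring,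
      show -d * (Y.1 - X.1) + c * (Y.2 - X.2) = (1 / 2) * (C * q - D * p) by
        rw [hC, hD, hp, hq]
        linear_combination (d * (Y.1 - X.1) - c * (Y.2 - X.2)) * hEF,
      abs_mul, abs_of_pos (by norm_num : (0 : ℝ) < 1 / 2)] at h2
    have h3 := square_bound_abs hK hc (by norm_num) hcd h00 h10 h01 h11 hY hX hF hE
    rw [show -d * (F.1 - E.1) + c * (F.2 - E.2) = -D by rw [hD, hx, hy]; ring, abs_neg,
      show c * (Y.1 - X.1) + d * (Y.2 - X.2) = (1 / 2) * (D * q - -C * p) by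
        rw [hC, hD, hp, hq]
        linear_combination (-(c * (Y.1 - X.1)) - d * (Y.2 - X.2)) * hEF,
      abs_mul, abs_of_pos (by norm_num : (0 : ℝ) < 1 / 2)] at h3
    refine ⟨?_, ?_, ?_⟩ <;> linarith
  have unit : ∀ X Y : ℝ × ℝ, (Y.1 - X.1) ^ 2 + (Y.2 - X.2) ^ 2 = 1 / 4 →
      (2 * ((Y.1 - X.1) * x + (Y.2 - X.2) * y)) ^ 2 +
        (2 * (x * (Y.2 - X.2) - y * (Y.1 - X.1))) ^ 2 = 1 := by
    intro X Y h
    linear_combination 4 * (x ^ 2 + y ^ 2) * h + hEF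
  obtain ⟨a1, a2, a3⟩ := side P hP Q hQ _ _ rfl rfl
  obtain ⟨b1, b2, b3⟩ := side Q hQ R hR _ _ rfl rfl
  obtain ⟨c1, c2, c3⟩ := side R hR P hP _ _ rfl rfl
  -- The axis of the square that is closer to the segment's direction plays the role of `e`.
  rcases le_total |D| |C| with h | h
  · have := side_bound hCD h hk (unit _ _ hPQ) (unit _ _ hQR) (unit _ _ hRP) (by ring) (by ring)
      a1 b1 c1 a2 b2 c2
    linarith
  · have := side_bound (c := D) (d := -C) (by linarith) (by rwa [abs_neg])
      (by rw [abs_neg]; linarith) (unit _ _ hPQ) (unit _ _ hQR) (unit _ _ hRP) (by ring) (by ring)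
      a1 b1 c1 a3 b3 c3
    linarith

/-! ### Transfer to the Euclidean plane -/

/-- The coordinates of a point of the Euclidean plane, as a measurable equivalence. -/
noncomputable def planeCoords : Plane ≃ᵐ ℝ × ℝ :=
  (MeasurableEquiv.toLp 2 (Fin 2 → ℝ)).symm.trans MeasurableEquiv.finTwoArrow

lemma planeCoords_apply (z : Plane) : planeCoords z = (z 0, z 1) := rfl

lemma measureReal_image_planeCoords (K : Set Plane) :
    volume.real (planeCoords '' K) = volume.real K := by
  have h : MeasurePreserving planeCoords :=
    (volume_preserving_finTwoArrow ℝ).comp (PiLp.volume_preserving_ofLp (Fin 2))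
  rw [MeasurableEquiv.image_eq_preimage_symm, Measure.real,
    (h.symm planeCoords).measure_preimage_equiv, Measure.real]

lemma dist_sq_eq (X Y : Plane) : dist X Y ^ 2 = (Y 0 - X 0) ^ 2 + (Y 1 - X 1) ^ 2 := by
  rw [EuclideanSpace.dist_eq, Real.sq_sqrt (by positivity), Fin.sum_univ_two, Real.dist_eq,
    Real.dist_eq, sq_abs, sq_abs]
  ring

/-- Two orthogonal vectors of equal length differ by a quarter turn, in one of the two senses. -/
lemma quarter_turn_of_orthogonal {a b c d r : ℝ} (h₁ : a ^ 2 + b ^ 2 = r)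
    (h₂ : c ^ 2 + d ^ 2 = r) (h : a * c + b * d = 0) : (c = -b ∧ d = a) ∨ (a = -d ∧ b = c) := by
  have hw : (a * d - b * c - r) * (a * d - b * c + r) = 0 := by
    linear_combination (c ^ 2 + d ^ 2) * h₁ + r * h₂ - (a * c + b * d) * h
  rcases mul_eq_zero.1 hw with h | h
  · have h3 : (c + b) ^ 2 + (d - a) ^ 2 = 0 := by linear_combination h₁ + h₂ - 2 * h
    have h4 : c + b = 0 := pow_eq_zero_iff two_ne_zero |>.1 (by nlinarith)
    have h5 : d - a = 0 := pow_eq_zero_iff two_ne_zero |>.1 (by nlinarith)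
    exact Or.inl ⟨by linarith, by linarith⟩
  · have h3 : (a + d) ^ 2 + (b - c) ^ 2 = 0 := by linear_combination h₁ + h₂ + 2 * h
    have h4 : a + d = 0 := pow_eq_zero_iff two_ne_zero |>.1 (by nlinarith)
    have h5 : b - c = 0 := pow_eq_zero_iff two_ne_zero |>.1 (by nlinarith)
    exact Or.inr ⟨by linarith, by linarith⟩

theorem theorem1 (L T S : Set Plane)
    (hL : IsSegmentOfLength 1 L)
    (hT : IsEquilateralTriangle (1 / 2) T)
    (hS : IsSquareOfSide (1 / 3) S) :
    (0.227498 : ℝ) ≤ (MeasureTheory.volume : MeasureTheory.Measure Plane).real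
      (convexHull ℝ (L ∪ T ∪ S)) := by
  obtain ⟨E, F, hEF, rfl⟩ := hL
  obtain ⟨P, Q, R, hPQ, hQR, hRP, rfl⟩ := hT
  obtain ⟨A, B, C, D, hpar, hAB, hBC, hang, rfl⟩ := hS
  set K := convexHull ℝ (segment ℝ E F ∪ convexHull ℝ {P, Q, R} ∪ convexHull ℝ {A, B, C, D})
    with hKdef
  have hcompact : IsCompact K := by
    have h : K = convexHull ℝ (({E, F} ∪ {P, Q, R}) ∪ {A, B, C, D}) := by
      rw [hKdef, ← convexHull_pair, convexHull_convexHull_union_right,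
        ← convexHull_convexHull_union_left (convexHull ℝ {E, F} ∪ _),
        convexHull_convexHull_union_right, convexHull_convexHull_union_left,
        union_assoc, convexHull_convexHull_union_left, ← union_assoc]
    rw [h]
    exact Set.Finite.isCompact_convexHull (𝕜 := ℝ) (Set.toFinite _)
  have hLK : segment ℝ E F ⊆ K := fun x hx => subset_convexHull ℝ _ (Or.inl (Or.inl hx))
  have hTK : ∀ x ∈ ({P, Q, R} : Set Plane), x ∈ K := fun x hx =>
    subset_convexHull ℝ _ (Or.inl (Or.inr (subset_convexHull ℝ _ hx)))
  have hSK : ∀ x ∈ ({A, B, C, D} : Set Plane), x ∈ K := fun x hx =>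
    subset_convexHull ℝ _ (Or.inr (subset_convexHull ℝ _ hx))
  have hmem : ∀ {x : Plane}, x ∈ K → planeCoords x ∈ planeCoords '' K := fun hx =>
    mem_image_of_mem _ hx
  have hconv : Convex ℝ (planeCoords '' K) := by
    rintro _ ⟨x, hx, rfl⟩ _ ⟨y, hy, rfl⟩ a b ha hb hab
    exact ⟨a • x + b • y, convex_convexHull ℝ _ hx hy ha hb hab, rfl⟩
  have hcomp : IsCompact (planeCoords '' K) := by
    refine hcompact.image ?_
    show Continuous fun z : Plane => (z 0, z 1)
    fun_prop
  have dist1 : ∀ {X Y : Plane} {r : ℝ}, dist X Y = r →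
      (Y 0 - X 0) ^ 2 + (Y 1 - X 1) ^ 2 = r ^ 2 := by
    intro X Y r h
    rw [← dist_sq_eq, h]
  have e1 := dist1 hEF
  have e2 := dist1 hPQ
  have e3 := dist1 hQR
  have e4 := dist1 hRP
  have e5 := dist1 hAB
  have e6 := dist1 hBC
  have e7 : (A 0 - B 0) * (C 0 - B 0) + (A 1 - B 1) * (C 1 - B 1) = 0 := by
    rw [EuclideanGeometry.angle, ← InnerProductGeometry.inner_eq_zero_iff_angle_eq_pi_div_two] at hang
    simp [PiLp.inner_apply, Fin.sum_univ_two] at hang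
    linarith
  have hD : ∀ i, D i = A i + C i - B i := by
    intro i
    have := congrArg (fun v : Plane => v i) hpar
    simp at this
    linarith
  rw [← measureReal_image_planeCoords]
  -- From here on only the membership, convexity and compactness facts about `K` matter.
  clear_value K
  have hAK := hmem (hSK A (by simp))
  have hBK := hmem (hSK B (by simp))
  have hCK := hmem (hSK C (by simp))
  have hDK := hmem (hSK D (by simp))
  simp only [planeCoords_apply, hD] at hAK hBK hCK hDK
  have bound := fun c d => area_bound (c := c) (d := d) (B := (B 0, B 1)) hconv hcomp
    (hmem (hLK (left_mem_segment ℝ E F))) (hmem (hLK (right_mem_segment ℝ E F)))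
    (hmem (hTK P (by simp))) (hmem (hTK Q (by simp))) (hmem (hTK R (by simp)))
    (by simp only [planeCoords_apply]; linarith) (by simp only [planeCoords_apply]; linarith)
    (by simp only [planeCoords_apply]; linarith) (by simp only [planeCoords_apply]; linarith)
  simp only [Prod.smul_mk, Prod.mk_add_mk, smul_eq_mul] at bound
  have hmem' : ∀ {u v u' v' : ℝ}, (u, v) ∈ planeCoords '' K → u' = u → v' = v →
      (u', v') ∈ planeCoords '' K := by
    rintro u v u' v' h rfl rfl
    exact h
  -- The square's frame at `B` is `(BA, BC)` or `(BC, BA)`, whichever is positively oriented.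
  rcases quarter_turn_of_orthogonal (r := 1 / 9) (by linarith) (by linarith) e7
    with ⟨h1, h2⟩ | ⟨h1, h2⟩
  · exact bound (3 * (A 0 - B 0)) (3 * (A 1 - B 1)) (by linarith) hBK
      (hmem' hAK (by linarith) (by linarith)) (hmem' hCK (by linarith) (by linarith))
      (hmem' hDK (by linarith) (by linarith))
  · exact bound (3 * (C 0 - B 0)) (3 * (C 1 - B 1)) (by linarith) hBK
      (hmem' hCK (by linarith) (by linarith)) (hmem' hAK (by linarith) (by linarith))
      (hmem' hDK (by linarith) (by linarith))
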